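/- A strongly antimagic labeling of a finite simple graph $G$ with $m$ edges is a bijection $f : E(G) \to \{1, 2, \ldots, m\}$ such that, writing $\phi_f(x) = \sum_{e \ni x} f(e)$ for the sum of the labels of the edges incident to the vertex $x$, one has $\phi_f(u) \neq \phi_f(v)$ for all distinct vertices $u, v$, and $\phi_f(u) > \phi_f(v)$ whenever $\deg(u) > \deg(v)$. The graph $G$ is strongly antimagic if it has such a labeling. A cycle double spider is a graph obtained from a path of length at least $1$ with ends $u$ and $v$ by attaching finitely many, and at least one, cycles at $u$ and finitely many, and at least one, cycles at $v$. The cycles have arbitrary (equal or different) lengths at least $3$; each attached cycle shares with the path only the end at which it is attached, and distinct attached cycles share no vertex except that end when they are attached at the same end. Theorem. Every cycle double spider is strongly antimagic. -/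

import Mathlib

/-- The vertex sum `φ_f(v)`: the sum of the labels `f e` over all edges `e` of `G` incident to `v`. -/
def vertexSum {V : Type*} [Fintype V] [DecidableEq V] (G : SimpleGraph V) [DecidableRel G.Adj]
    (f : Sym2 V → ℕ) (v : V) : ℕ :=
  ∑ e ∈ G.incidenceFinset v, f e

/-- `f` is an antimagic labeling of `G`: it maps the edge set of `G` bijectively onto
`{1, …, m}`, where `m` is the number of edges, and distinct vertices have distinct vertex sums.
(Labels are given by a function on all unordered pairs; only its values on edges matter.) -/
structure IsAntimagicLabeling {V : Type*} [Fintype V] [DecidableEq V] (G : SimpleGraph V)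
    [DecidableRel G.Adj] (f : Sym2 V → ℕ) : Prop where
  bijOn : Set.BijOn f G.edgeSet (Set.Icc 1 G.edgeFinset.card)
  vertexSum_ne : ∀ u v : V, u ≠ v → vertexSum G f u ≠ vertexSum G f v

/-- `f` is a strongly antimagic labeling of `G`: it is an antimagic labeling, and a vertex of
larger degree has a larger vertex sum. -/
structure IsStronglyAntimagicLabeling {V : Type*} [Fintype V] [DecidableEq V]
    (G : SimpleGraph V) [DecidableRel G.Adj] (f : Sym2 V → ℕ) : Prop
    extends IsAntimagicLabeling G f where
  vertexSum_lt : ∀ u v : V, G.degree v < G.degree u → vertexSum G f v < vertexSum G f u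

/-- `G` is strongly antimagic if it has a strongly antimagic labeling. -/
def IsStronglyAntimagic {V : Type*} [Fintype V] [DecidableEq V] (G : SimpleGraph V)
    [DecidableRel G.Adj] : Prop :=
  ∃ f : Sym2 V → ℕ, IsStronglyAntimagicLabeling G f

/-- Vertices of the graph obtained from a path with `x` edges by attaching at its first end cycles
of lengths `p 0, …, p (a - 1)` and at its last end cycles of lengths `q 0, …, q (b - 1)`.
* `mid s` is the `s`-th vertex of the path; the two ends are `mid 0` and `mid x`.
* `left i t` are the `p i - 1` vertices, other than `mid 0`, of the `i`-th cycle at `mid 0`.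
* `right j t` are the `q j - 1` vertices, other than `mid x`, of the `j`-th cycle at `mid x`. -/
inductive CDSVertex (x : ℕ) {a b : ℕ} (p : Fin a → ℕ) (q : Fin b → ℕ) : Type
  | mid (s : Fin (x + 1)) : CDSVertex x p q
  | left (i : Fin a) (t : Fin (p i - 1)) : CDSVertex x p q
  | right (j : Fin b) (t : Fin (q j - 1)) : CDSVertex x p q

/-- The edges, each given in one direction: consecutive vertices of the path, consecutive new
vertices of the same cycle, and the edges that join the two extreme new vertices of a cycle to
the end of the path at which the cycle is attached. -/
inductive CDSEdge (x : ℕ) {a b : ℕ} (p : Fin a → ℕ) (q : Fin b → ℕ) :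
    CDSVertex x p q → CDSVertex x p q → Prop
  | mid (s t : Fin (x + 1)) (h : t.val = s.val + 1) : CDSEdge x p q (.mid s) (.mid t)
  | left (i : Fin a) (s t : Fin (p i - 1)) (h : t.val = s.val + 1) :
      CDSEdge x p q (.left i s) (.left i t)
  | right (j : Fin b) (s t : Fin (q j - 1)) (h : t.val = s.val + 1) :
      CDSEdge x p q (.right j s) (.right j t)
  | leftFirst (i : Fin a) (t : Fin (p i - 1)) (h : t.val = 0) :
      CDSEdge x p q (.mid 0) (.left i t)
  | leftLast (i : Fin a) (t : Fin (p i - 1)) (h : t.val + 2 = p i) :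
      CDSEdge x p q (.mid 0) (.left i t)
  | rightFirst (j : Fin b) (t : Fin (q j - 1)) (h : t.val = 0) :
      CDSEdge x p q (.mid (Fin.last x)) (.right j t)
  | rightLast (j : Fin b) (t : Fin (q j - 1)) (h : t.val + 2 = q j) :
      CDSEdge x p q (.mid (Fin.last x)) (.right j t)

/-- The graph obtained from a path with `x` edges by attaching cycles of lengths `p i` at its
first end and cycles of lengths `q j` at its last end. -/
def cycleDoubleSpider (x : ℕ) {a b : ℕ} (p : Fin a → ℕ) (q : Fin b → ℕ) :
    SimpleGraph (CDSVertex x p q) :=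
  SimpleGraph.fromRel (CDSEdge x p q)

/-- `G` is a cycle double spider: up to isomorphism, it is obtained from a path of length at least
one by attaching at least one cycle, each of length at least three, to each of its two ends. -/
def IsCycleDoubleSpider {V : Type*} (G : SimpleGraph V) : Prop :=
  ∃ (x a b : ℕ) (p : Fin a → ℕ) (q : Fin b → ℕ),
    1 ≤ x ∧ 1 ≤ a ∧ 1 ≤ b ∧ (∀ i, 3 ≤ p i) ∧ (∀ j, 3 ≤ q j) ∧
      Nonempty (G ≃g cycleDoubleSpider x p q)

/-! Cut every cycle open at its hub, the end of the path where it is attached. The edges then form a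
family of paths: the central one with `x` edges, and one per cycle, with `N` edges in all the
cycles. The sum at a vertex of degree 2 is a sum of two consecutive labels, and a hub sum is one end
label of the central path plus all the end labels of its cycles. So three things are needed:
distinct consecutive sums, hub sums above all of them, and hub sums that differ and are ordered by
the number of cycles.

Distinctness inside one path comes from `pathLabel`; between paths labelled by disjoint intervals it
is automatic (`IsPathLabeling.sum`). Large hub sums come from one chosen cycle at each hub: together
these two cycles take the top labels among the cycles, with the four largest on their extreme edges
(`exists_isPairLabeling`). Their end sums are `2N - 1` and `2N - 5`, and all consecutive sums on
cycles are at most `2N - 4`.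

Let the first hub have at least as many cycles. Its remaining cycles take the interval just below
the chosen pair, and those of the other hub take the lowest one. Each remaining cycle of the first
hub then beats each one of the second by more than 5, enough to outweigh any deficit from the pair
and the path (`isSpiderLabeling_of_bounds`). The path takes the label above all others if `x = 1`.
Otherwise it takes the labels `1, …, x`, oriented to help the weaker of the two chosen cycles. -/

/-! ### Labelings of families of paths -/

/-- A family of paths with `len i` edges each is labelled by `L`, the `t`-th edge of the `i`-th path
getting `L i t`: labels are distinct numbers in `{1, …, N}`, and the sums of two consecutive
labels on a path are distinct. -/
structure IsPathLabeling {ι : Type*} (len : ι → ℕ) (N : ℕ) (L : ι → ℕ → ℕ) : Prop where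
  pos : ∀ i t, t < len i → 1 ≤ L i t
  le : ∀ i t, t < len i → L i t ≤ N
  inj : ∀ i j s t, s < len i → t < len j → L i s = L j t → i = j ∧ s = t
  sum_inj : ∀ i j s t, s + 1 < len i → t + 1 < len j →
    L i s + L i (s + 1) = L j t + L j (t + 1) → i = j ∧ s = t

theorem IsPathLabeling.comp {ι κ : Type*} {len : ι → ℕ} {N : ℕ} {L : ι → ℕ → ℕ}
    (h : IsPathLabeling len N L) (g : κ → ι) (hg : Function.Injective g) :
    IsPathLabeling (len ∘ g) N (L ∘ g) where
  pos i t := h.pos _ t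
  le i t := h.le _ t
  inj i j s t hs ht e := by
    obtain ⟨h1, h2⟩ := h.inj _ _ s t hs ht e
    exact ⟨hg h1, h2⟩
  sum_inj i j s t hs ht e := by
    obtain ⟨h1, h2⟩ := h.sum_inj _ _ s t hs ht e
    exact ⟨hg h1, h2⟩

theorem IsPathLabeling.sum_lt {ι : Type*} {len : ι → ℕ} {N : ℕ} {L : ι → ℕ → ℕ}
    (h : IsPathLabeling len N L) (i : ι) (t : ℕ) (ht : t + 1 < len i) :
    L i t + L i (t + 1) < 2 * N := by
  have h1 := h.le i t (by omega)
  have h2 := h.le i (t + 1) ht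
  have h3 : L i t ≠ L i (t + 1) := fun e => by
    have := (h.inj i i t (t + 1) (by omega) ht e).2
    omega
  omega

/-- Two labelled families side by side, the labels of the second one raised above those of the
first. -/
theorem IsPathLabeling.sum {ι κ : Type*} {len : ι → ℕ} {len' : κ → ℕ} {N N' : ℕ}
    {L : ι → ℕ → ℕ} {L' : κ → ℕ → ℕ} (h : IsPathLabeling len N L)
    (h' : IsPathLabeling len' N' L') :
    IsPathLabeling (Sum.elim len len') (N + N') (Sum.elim L fun i t => N + L' i t) where
  pos := by
    rintro (i | i) t ht
    · exact h.pos i t ht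
    · exact (h'.pos i t ht).trans (Nat.le_add_left _ _)
  le := by
    rintro (i | i) t ht
    · exact (h.le i t ht).trans (Nat.le_add_right _ _)
    · exact Nat.add_le_add_left (h'.le i t ht) _
  inj := by
    rintro (i | i) (j | j) s t hs ht e <;> simp only [Sum.elim_inl, Sum.elim_inr] at hs ht e
    · simpa using h.inj i j s t hs ht e
    · have := h.le i s hs
      have := h'.pos j t ht
      omega
    · have := h.le j t ht
      have := h'.pos i s hs
      omega
    · simpa using h'.inj i j s t hs ht (by omega)
  sum_inj := by
    rintro (i | i) (j | j) s t hs ht e <;> simp only [Sum.elim_inl, Sum.elim_inr] at hs ht e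
    · simpa using h.sum_inj i j s t hs ht e
    -- Sums in the lower family stay below `2 * N`; raised ones exceed it.
    · have := h.sum_lt i s hs
      omega
    · have := h.sum_lt j t ht
      omega
    · simpa using h'.sum_inj i j s t hs ht (by omega)

/-! ### Labeling paths by intervals -/

/-- The labels `p, p - 2, …, p - 3, p - 1` of a path with `p` edges: even and odd ones descend
from the two ends. -/
def pathLabel (p t : ℕ) : ℕ :=
  if 2 * t < p then p - 2 * t else 2 * t + 1 - p

theorem pathLabel_zero {p : ℕ} (hp : 1 ≤ p) : pathLabel p 0 = p := by
  unfold pathLabel; split_ifs <;> omega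

theorem pathLabel_last {p : ℕ} (hp : 2 ≤ p) : pathLabel p (p - 1) = p - 1 := by
  unfold pathLabel; split_ifs <;> omega

/-- The sums are `2p - 2, 2p - 6, …` from the front and `2p - 4, 2p - 8, …` from the back, even
numbers in different classes modulo 4, and the odd value `1 + 2` where the two halves meet. -/
theorem isPathLabeling_pathLabel (p : ℕ) :
    IsPathLabeling (fun _ : Unit => p) p (fun _ => pathLabel p) where
  pos _ t ht := by unfold pathLabel; split_ifs <;> omega
  le _ t ht := by unfold pathLabel; split_ifs <;> omega
  inj _ _ s t hs ht e := by
    refine ⟨rfl, ?_⟩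
    unfold pathLabel at e; split_ifs at e <;> omega
  sum_inj _ _ s t hs ht e := by
    refine ⟨rfl, ?_⟩
    unfold pathLabel at e; split_ifs at e <;> omega

/-- Paths of arbitrary lengths, each labelled with its own interval of labels. -/
theorem exists_isPathLabeling_fin {n : ℕ} (len : Fin n → ℕ) (hlen : ∀ i, 2 ≤ len i) :
    ∃ L : Fin n → ℕ → ℕ, IsPathLabeling len (∑ i, len i) L ∧
      ∀ i, L i 0 + L i (len i - 1) + 1 ≤ 2 * ∑ i, len i ∧
        2 * len i ≤ L i 0 + L i (len i - 1) + 1 := by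
  induction n with
  | zero => exact ⟨fun _ _ => 0, ⟨fun i => i.elim0, fun i => i.elim0, fun i => i.elim0,
      fun i => i.elim0⟩, fun i => i.elim0⟩
  | succ n ih =>
    obtain ⟨L, hL, hb⟩ := ih (fun i => len i.castSucc) (fun i => hlen _)
    have h := (hL.sum (isPathLabeling_pathLabel (len (Fin.last n)))).comp
      (fun i : Fin (n + 1) => Fin.lastCases (motive := fun _ => Fin n ⊕ Unit) (Sum.inr ())
        Sum.inl i) (by
        intro i j
        refine Fin.lastCases ?_ (fun i => ?_) i <;> refine Fin.lastCases ?_ (fun j => ?_) j <;>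
          simp)
    rw [← Fin.sum_univ_castSucc] at h
    have hl : (Sum.elim (fun i : Fin n => len i.castSucc) fun _ : Unit => len (Fin.last n)) ∘
        (fun i : Fin (n + 1) => Fin.lastCases (motive := fun _ => Fin n ⊕ Unit) (Sum.inr ())
        Sum.inl i) = len := by
      funext i
      refine Fin.lastCases ?_ (fun i => ?_) i <;> simp
    rw [hl] at h
    refine ⟨_, h, fun i => ?_⟩
    have := Fin.sum_univ_castSucc len
    refine Fin.lastCases ?_ (fun i => ?_) i
    · have h1 := hlen (Fin.last n)
      have h2 := pathLabel_zero (p := len (Fin.last n)) (by omega)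
      have h3 := pathLabel_last h1
      simp only [Function.comp_apply, Fin.lastCases_last, Sum.elim_inr]
      omega
    · have := hb i
      simp only [Function.comp_apply, Fin.lastCases_castSucc, Sum.elim_inl]
      omega

/-! ### Two paths carrying the four largest labels at their ends -/

/-- Two paths with `p` and `q` edges labelled such that their ends carry the four largest
labels. -/
structure IsPairLabeling (p q : ℕ) (X Y : ℕ → ℕ) : Prop where
  left_zero : X 0 = p + q
  left_last : X (p - 1) + 1 = p + q
  right_zero : Y 0 + 2 = p + q
  right_last : Y (q - 1) + 3 = p + q
  left_mem : ∀ t, t < p → 1 ≤ X t ∧ X t ≤ p + q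
  right_mem : ∀ t, t < q → 1 ≤ Y t ∧ Y t ≤ p + q
  left_inj : ∀ s t, s < p → t < p → X s = X t → s = t
  right_inj : ∀ s t, s < q → t < q → Y s = Y t → s = t
  ne : ∀ s t, s < p → t < q → X s ≠ Y t
  left_sum_le : ∀ t, t + 1 < p → X t + X (t + 1) + 4 ≤ 2 * (p + q)
  right_sum_le : ∀ t, t + 1 < q → Y t + Y (t + 1) + 4 ≤ 2 * (p + q)
  left_sum_inj : ∀ s t, s + 1 < p → t + 1 < p → X s + X (s + 1) = X t + X (t + 1) → s = t
  right_sum_inj : ∀ s t, s + 1 < q → t + 1 < q → Y s + Y (s + 1) = Y t + Y (t + 1) → s = t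
  sum_ne : ∀ s t, s + 1 < p → t + 1 < q → X s + X (s + 1) ≠ Y t + Y (t + 1)

/-- The labels of a path with `p + 2` edges, given its two extreme labels `a`, `b` and the labels
`f` of the `p` edges between. -/
def wrapLabel (p a b : ℕ) (f : ℕ → ℕ) (t : ℕ) : ℕ :=
  if t = 0 then a else if t ≤ p then f (t - 1) else b

theorem wrapLabel_sum (p a b : ℕ) (f : ℕ → ℕ) (hp : 1 ≤ p) (t : ℕ) (ht : t < p + 1) :
    t = 0 ∧ wrapLabel p a b f t + wrapLabel p a b f (t + 1) = a + f 0 ∨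
    t = p ∧ wrapLabel p a b f t + wrapLabel p a b f (t + 1) = f (p - 1) + b ∨
    ∃ s, t = s + 1 ∧ s + 1 < p ∧
      wrapLabel p a b f t + wrapLabel p a b f (t + 1) = f s + f (s + 1) := by
  rcases t with _ | t
  · left; simp [wrapLabel, hp]
  · right
    by_cases h : t + 1 = p
    · left; subst h; simp [wrapLabel]
    · right
      refine ⟨t, rfl, by omega, ?_⟩
      have h1 : t + 1 ≤ p := by omega
      have h2 : t + 1 + 1 ≤ p := by omega
      simp [wrapLabel, h1, h2]

theorem wrapLabel_cases (p a b : ℕ) (f : ℕ → ℕ) (t : ℕ) (ht : t < p + 2) :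
    t = 0 ∧ wrapLabel p a b f t = a ∨ t = p + 1 ∧ wrapLabel p a b f t = b ∨
    ∃ s, t = s + 1 ∧ s < p ∧ wrapLabel p a b f t = f s := by
  rcases t with _ | t
  · left; simp [wrapLabel]
  · right
    by_cases h : t = p
    · left; subst h; simp [wrapLabel]
    · right
      have h1 : t + 1 ≤ p := by omega
      exact ⟨t, rfl, by omega, by simp [wrapLabel, h1]⟩

/-- With `n = p + q`, the four new sums are `2n + 4`, `2n + 2`, `2n` and `2n - 2`: distinct, and
above the old sums, which are at most `2n - 4`. The largest of them meets the new bound `2(n + 4) -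
4` exactly, so the induction closes. -/
theorem IsPairLabeling.wrap {p q : ℕ} {X Y : ℕ → ℕ} (h : IsPairLabeling p q X Y)
    (hp : 2 ≤ p) (hq : 2 ≤ q) :
    IsPairLabeling (p + 2) (q + 2) (wrapLabel p (p + q + 4) (p + q + 3) X)
      (wrapLabel q (p + q + 2) (p + q + 1) Y) := by
  have hX := wrapLabel_cases p (p + q + 4) (p + q + 3) X
  have hY := wrapLabel_cases q (p + q + 2) (p + q + 1) Y
  have hXs := wrapLabel_sum p (p + q + 4) (p + q + 3) X (by omega)
  have hYs := wrapLabel_sum q (p + q + 2) (p + q + 1) Y (by omega)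
  have e1 := h.left_zero
  have e2 := h.left_last
  have e3 := h.right_zero
  have e4 := h.right_last
  constructor
  · simp [wrapLabel]; omega
  · simp [wrapLabel]; omega
  · simp [wrapLabel]; omega
  · simp [wrapLabel]; omega
  · intro t ht
    rcases hX t ht with ⟨_, h1⟩ | ⟨_, h1⟩ | ⟨s, _, hs, h1⟩
    · omega
    · omega
    · have := h.left_mem s hs
      omega
  · intro t ht
    rcases hY t ht with ⟨_, h1⟩ | ⟨_, h1⟩ | ⟨s, _, hs, h1⟩
    · omega
    · omega
    · have := h.right_mem s hs
      omega
  · intro s t hs ht e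
    rcases hX s hs with ⟨_, h1⟩ | ⟨_, h1⟩ | ⟨s', _, hs', h1⟩ <;>
    rcases hX t ht with ⟨_, h2⟩ | ⟨_, h2⟩ | ⟨t', _, ht', h2⟩ <;>
    try have i1 := h.left_mem s' hs'
    all_goals try have i2 := h.left_mem t' ht'
    all_goals try have i3 := h.left_inj s' t' hs' ht'
    all_goals omega
  · intro s t hs ht e
    rcases hY s hs with ⟨_, h1⟩ | ⟨_, h1⟩ | ⟨s', _, hs', h1⟩ <;>
    rcases hY t ht with ⟨_, h2⟩ | ⟨_, h2⟩ | ⟨t', _, ht', h2⟩ <;>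
    try have i1 := h.right_mem s' hs'
    all_goals try have i2 := h.right_mem t' ht'
    all_goals try have i3 := h.right_inj s' t' hs' ht'
    all_goals omega
  · intro s t hs ht e
    rcases hX s hs with ⟨_, h1⟩ | ⟨_, h1⟩ | ⟨s', _, hs', h1⟩ <;>
    rcases hY t ht with ⟨_, h2⟩ | ⟨_, h2⟩ | ⟨t', _, ht', h2⟩ <;>
    try have i1 := h.left_mem s' hs'
    all_goals try have i2 := h.right_mem t' ht'
    all_goals try have i3 := h.ne s' t' hs' ht'
    all_goals omega
  · intro t ht
    rcases hXs t (by omega) with ⟨_, h1⟩ | ⟨_, h1⟩ | ⟨s, _, hs, h1⟩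
    · omega
    · omega
    · have := h.left_sum_le s hs
      omega
  · intro t ht
    rcases hYs t (by omega) with ⟨_, h1⟩ | ⟨_, h1⟩ | ⟨s, _, hs, h1⟩
    · omega
    · omega
    · have := h.right_sum_le s hs
      omega
  · intro s t hs ht e
    rcases hXs s (by omega) with ⟨_, h1⟩ | ⟨_, h1⟩ | ⟨s', _, hs', h1⟩ <;>
    rcases hXs t (by omega) with ⟨_, h2⟩ | ⟨_, h2⟩ | ⟨t', _, ht', h2⟩ <;>
    try have i1 := h.left_sum_le s' hs'
    all_goals try have i2 := h.left_sum_le t' ht'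
    all_goals try have i3 := h.left_sum_inj s' t' hs' ht'
    all_goals omega
  · intro s t hs ht e
    rcases hYs s (by omega) with ⟨_, h1⟩ | ⟨_, h1⟩ | ⟨s', _, hs', h1⟩ <;>
    rcases hYs t (by omega) with ⟨_, h2⟩ | ⟨_, h2⟩ | ⟨t', _, ht', h2⟩ <;>
    try have i1 := h.right_sum_le s' hs'
    all_goals try have i2 := h.right_sum_le t' ht'
    all_goals try have i3 := h.right_sum_inj s' t' hs' ht'
    all_goals omega
  · intro s t hs ht e
    rcases hXs s (by omega) with ⟨_, h1⟩ | ⟨_, h1⟩ | ⟨s', _, hs', h1⟩ <;>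
    rcases hYs t (by omega) with ⟨_, h2⟩ | ⟨_, h2⟩ | ⟨t', _, ht', h2⟩ <;>
    try have i1 := h.left_sum_le s' hs'
    all_goals try have i2 := h.right_sum_le t' ht'
    all_goals try have i3 := h.sum_ne s' t' hs' ht'
    all_goals omega

/-- The short path has sums `2k + 6` and `2k + 5`. The long one has `2k + 3` at its front, at most
`2k + 2` at its back, and sums below `2k` inside. -/
theorem isPairLabeling_three {k : ℕ} (hk : 1 ≤ k) :
    IsPairLabeling 3 (k + 2) (fun t => if t = 0 then k + 5 else if t = 1 then k + 1 else k + 4)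
      (wrapLabel k (k + 3) (k + 2) (pathLabel k)) := by
  have hP := isPathLabeling_pathLabel k
  have hY := wrapLabel_cases k (k + 3) (k + 2) (pathLabel k)
  have hYs := wrapLabel_sum k (k + 3) (k + 2) (pathLabel k) hk
  have e1 := pathLabel_zero hk
  have e2 : pathLabel k (k - 1) ≤ k ∧ k ≤ pathLabel k (k - 1) + 1 := by
    unfold pathLabel; split_ifs <;> omega
  constructor
  · simp; omega
  · simp; omega
  · simp [wrapLabel]; omega
  · simp [wrapLabel]; omega
  · intro t ht
    split_ifs <;> omega
  · intro t ht
    rcases hY t ht with ⟨_, h1⟩ | ⟨_, h1⟩ | ⟨s, _, hs, h1⟩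
    · omega
    · omega
    · have := hP.pos () s hs
      have := hP.le () s hs
      omega
  · intro s t hs ht e
    split_ifs at e <;> omega
  · intro s t hs ht e
    rcases hY s hs with ⟨_, h1⟩ | ⟨_, h1⟩ | ⟨s', _, hs', h1⟩ <;>
    rcases hY t ht with ⟨_, h2⟩ | ⟨_, h2⟩ | ⟨t', _, ht', h2⟩ <;>
    try have i1 := hP.le () s' hs'
    all_goals try have i2 := hP.le () t' ht'
    all_goals try have i3 := hP.inj () () s' t' hs' ht'
    all_goals omega
  · intro s t hs ht e
    rcases hY t ht with ⟨_, h2⟩ | ⟨_, h2⟩ | ⟨t', _, ht', h2⟩ <;>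
    try have i2 := hP.le () t' ht'
    all_goals split_ifs at e <;> omega
  · intro t ht
    split_ifs <;> first | omega | contradiction
  · intro t ht
    rcases hYs t (by omega) with ⟨_, h1⟩ | ⟨_, h1⟩ | ⟨s, _, hs, h1⟩
    · omega
    · omega
    · have := hP.sum_lt () s hs
      omega
  · intro s t hs ht e
    split_ifs at e <;> omega
  · intro s t hs ht e
    rcases hYs s (by omega) with ⟨_, h1⟩ | ⟨_, h1⟩ | ⟨s', _, hs', h1⟩ <;>
    rcases hYs t (by omega) with ⟨_, h2⟩ | ⟨_, h2⟩ | ⟨t', _, ht', h2⟩ <;>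
    try have i1 := hP.sum_lt () s' hs'
    all_goals try have i2 := hP.sum_lt () t' ht'
    all_goals try have i3 := hP.sum_inj () () s' t' hs' ht'
    all_goals omega
  · intro s t hs ht e
    rcases hYs t (by omega) with ⟨_, h2⟩ | ⟨_, h2⟩ | ⟨t', _, ht', h2⟩ <;>
    try have i2 := hP.sum_lt () t' ht'
    all_goals split_ifs at e <;> omega

/-- The short path has sums `2k + 12`, `2k + 5`, `2k + 8`; the long one has `2k + 9` and `2k + 7` at
its ends and at most `2k + 3` inside. The inner block `Z` avoids `k + 1`, which the short path uses.
-/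
theorem isPairLabeling_four {k : ℕ} (hk : 1 ≤ k) :
    IsPairLabeling 4 (k + 2 + 2)
      (fun t => if t = 0 then k + 8 else if t = 1 then k + 4 else if t = 2 then k + 1 else k + 7)
      (wrapLabel (k + 2) (k + 6) (k + 5) (wrapLabel k (k + 3) (k + 2) (pathLabel k))) := by
  have hP := isPathLabeling_pathLabel k
  set Z := wrapLabel k (k + 3) (k + 2) (pathLabel k) with hZdef
  have hZ := wrapLabel_cases k (k + 3) (k + 2) (pathLabel k)
  have hZs := wrapLabel_sum k (k + 3) (k + 2) (pathLabel k) hk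
  rw [← hZdef] at hZ hZs
  have e1 := pathLabel_zero hk
  have e2 : pathLabel k (k - 1) ≤ k ∧ k ≤ pathLabel k (k - 1) + 1 := by
    unfold pathLabel; split_ifs <;> omega
  have e3 : Z 0 = k + 3 := by simp [hZdef, wrapLabel]
  have e4 : Z (k + 2 - 1) = k + 2 := by simp [hZdef, wrapLabel]
  have z1 : ∀ t, t < k + 2 → 1 ≤ Z t ∧ Z t ≤ k + 3 ∧ Z t ≠ k + 1 := by
    intro t ht
    rcases hZ t ht with ⟨_, h1⟩ | ⟨_, h1⟩ | ⟨s, _, hs, h1⟩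
    · omega
    · omega
    · have := hP.pos () s hs
      have := hP.le () s hs
      omega
  have z2 : ∀ s t, s < k + 2 → t < k + 2 → Z s = Z t → s = t := by
    intro s t hs ht e
    rcases hZ s hs with ⟨_, h1⟩ | ⟨_, h1⟩ | ⟨s', _, hs', h1⟩ <;>
    rcases hZ t ht with ⟨_, h2⟩ | ⟨_, h2⟩ | ⟨t', _, ht', h2⟩ <;>
    try have i1 := hP.le () s' hs'
    all_goals try have i2 := hP.le () t' ht'
    all_goals try have i3 := hP.inj () () s' t' hs' ht'
    all_goals omega
  have z3 : ∀ t, t + 1 < k + 2 → Z t + Z (t + 1) ≤ 2 * k + 3 := by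
    intro t ht
    rcases hZs t (by omega) with ⟨_, h1⟩ | ⟨_, h1⟩ | ⟨s, _, hs, h1⟩
    · omega
    · omega
    · have := hP.sum_lt () s hs
      omega
  have z4 : ∀ s t, s + 1 < k + 2 → t + 1 < k + 2 → Z s + Z (s + 1) = Z t + Z (t + 1) →
      s = t := by
    intro s t hs ht e
    rcases hZs s (by omega) with ⟨_, h1⟩ | ⟨_, h1⟩ | ⟨s', _, hs', h1⟩ <;>
    rcases hZs t (by omega) with ⟨_, h2⟩ | ⟨_, h2⟩ | ⟨t', _, ht', h2⟩ <;>
    try have i1 := hP.sum_lt () s' hs'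
    all_goals try have i2 := hP.sum_lt () t' ht'
    all_goals try have i3 := hP.sum_inj () () s' t' hs' ht'
    all_goals omega
  clear hZ hZs hP e1 e2
  clear_value Z
  have hY := wrapLabel_cases (k + 2) (k + 6) (k + 5) Z
  have hYs := wrapLabel_sum (k + 2) (k + 6) (k + 5) Z (by omega)
  constructor
  · simp; omega
  · simp; omega
  · simp [wrapLabel]; omega
  · simp [wrapLabel]; omega
  · intro t ht
    split_ifs <;> omega
  · intro t ht
    rcases hY t ht with ⟨_, h1⟩ | ⟨_, h1⟩ | ⟨s, _, hs, h1⟩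
    · omega
    · omega
    · have := z1 s hs
      omega
  · intro s t hs ht e
    split_ifs at e <;> omega
  · intro s t hs ht e
    rcases hY s hs with ⟨_, h1⟩ | ⟨_, h1⟩ | ⟨s', _, hs', h1⟩ <;>
    rcases hY t ht with ⟨_, h2⟩ | ⟨_, h2⟩ | ⟨t', _, ht', h2⟩ <;>
    try have i1 := z1 s' hs'
    all_goals try have i2 := z1 t' ht'
    all_goals try have i3 := z2 s' t' hs' ht'
    all_goals omega
  · intro s t hs ht e
    rcases hY t ht with ⟨_, h2⟩ | ⟨_, h2⟩ | ⟨t', _, ht', h2⟩ <;>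
    try have i2 := z1 t' ht'
    all_goals split_ifs at e <;> omega
  · intro t ht
    split_ifs <;> first | omega | contradiction
  · intro t ht
    rcases hYs t (by omega) with ⟨_, h1⟩ | ⟨_, h1⟩ | ⟨s, _, hs, h1⟩
    · omega
    · omega
    · have := z3 s hs
      omega
  · intro s t hs ht e
    split_ifs at e <;> omega
  · intro s t hs ht e
    rcases hYs s (by omega) with ⟨_, h1⟩ | ⟨_, h1⟩ | ⟨s', _, hs', h1⟩ <;>
    rcases hYs t (by omega) with ⟨_, h2⟩ | ⟨_, h2⟩ | ⟨t', _, ht', h2⟩ <;>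
    try have i1 := z3 s' hs'
    all_goals try have i2 := z3 t' ht'
    all_goals try have i3 := z4 s' t' hs' ht'
    all_goals omega
  · intro s t hs ht e
    rcases hYs t (by omega) with ⟨_, h2⟩ | ⟨_, h2⟩ | ⟨t', _, ht', h2⟩ <;>
    try have i2 := z3 t' ht'
    all_goals split_ifs at e <;> omega

/-- The pattern of `isPairLabeling_four` breaks at `k = 0`, where the sum 5 would occur on both
paths. -/
theorem isPairLabeling_four_four :
    IsPairLabeling 4 4
      (fun t => if t = 0 then 8 else if t = 1 then 4 else if t = 2 then 2 else 7)
      (fun t => if t = 0 then 6 else if t = 1 then 1 else if t = 2 then 3 else 5) := by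
  constructor <;> intros <;> (try split_ifs at *) <;> omega

/-- Unwrapping removes two edges from each path until the shorter one has 3 or 4. It cannot go on to
2: the labels `p + q` and `p + q - 1` would be adjacent and break the bound on sums. -/
theorem exists_isPairLabeling (p q : ℕ) (hp : 3 ≤ p) (hpq : p ≤ q) :
    ∃ X Y, IsPairLabeling p q X Y := by
  induction p using Nat.strong_induction_on generalizing q with
  | _ p ih =>
    by_cases h3 : p = 3
    · obtain ⟨k, rfl⟩ : ∃ k, q = k + 2 := ⟨q - 2, by omega⟩
      subst h3; exact ⟨_, _, isPairLabeling_three (by omega)⟩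
    by_cases h4 : p = 4
    · subst h4
      by_cases h5 : q = 4
      · subst h5; exact ⟨_, _, isPairLabeling_four_four⟩
      · obtain ⟨k, rfl⟩ : ∃ k, q = k + 2 + 2 := ⟨q - 4, by omega⟩
        exact ⟨_, _, isPairLabeling_four (by omega)⟩
    obtain ⟨p, rfl⟩ : ∃ r, p = r + 2 := ⟨p - 2, by omega⟩
    obtain ⟨q, rfl⟩ : ∃ r, q = r + 2 := ⟨q - 2, by omega⟩
    obtain ⟨X, Y, h⟩ := ih p (by omega) q (by omega) (by omega)
    exact ⟨_, _, h.wrap (by omega) (by omega)⟩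

theorem IsPairLabeling.isPathLabeling {p q : ℕ} {X Y : ℕ → ℕ} (h : IsPairLabeling p q X Y) :
    IsPathLabeling (Sum.elim (fun _ : Unit => p) fun _ : Unit => q) (p + q)
      (Sum.elim (fun _ => X) fun _ => Y) where
  pos := by
    rintro (_ | _) t ht
    exacts [(h.left_mem t ht).1, (h.right_mem t ht).1]
  le := by
    rintro (_ | _) t ht
    exacts [(h.left_mem t ht).2, (h.right_mem t ht).2]
  inj := by
    rintro (_ | _) (_ | _) s t hs ht e
    · exact ⟨rfl, h.left_inj s t hs ht e⟩
    · exact (h.ne s t hs ht e).elim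
    · exact (h.ne t s ht hs e.symm).elim
    · exact ⟨rfl, h.right_inj s t hs ht e⟩
  sum_inj := by
    rintro (_ | _) (_ | _) s t hs ht e
    · exact ⟨rfl, h.left_sum_inj s t hs ht e⟩
    · exact (h.sum_ne s t hs ht e).elim
    · exact (h.sum_ne t s ht hs e.symm).elim
    · exact ⟨rfl, h.right_sum_inj s t hs ht e⟩

/-- Two paths of arbitrary lengths labelled such that their ends carry the four largest labels,
two consecutive ones on each path. -/
theorem exists_isPathLabeling_pair (p q : ℕ) (hp : 3 ≤ p) (hq : 3 ≤ q) :
    ∃ L : Unit ⊕ Unit → ℕ → ℕ,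
      IsPathLabeling (Sum.elim (fun _ : Unit => p) fun _ : Unit => q) (p + q) L ∧
      (∀ i t, t + 1 < Sum.elim (fun _ : Unit => p) (fun _ : Unit => q) i →
        L i t + L i (t + 1) + 4 ≤ 2 * (p + q)) ∧
      (L (.inl ()) 0 + L (.inl ()) (p - 1) + 1 = 2 * (p + q) ∧
          L (.inr ()) 0 + L (.inr ()) (q - 1) + 5 = 2 * (p + q) ∨
        L (.inl ()) 0 + L (.inl ()) (p - 1) + 5 = 2 * (p + q) ∧
          L (.inr ()) 0 + L (.inr ()) (q - 1) + 1 = 2 * (p + q)) := by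
  rcases le_total p q with hpq | hpq
  · obtain ⟨X, Y, h⟩ := exists_isPairLabeling p q hp hpq
    refine ⟨_, h.isPathLabeling, ?_, Or.inl ?_⟩
    · rintro (_ | _) t ht
      exacts [h.left_sum_le t ht, h.right_sum_le t ht]
    · have := h.left_zero
      have := h.left_last
      have := h.right_zero
      have := h.right_last
      simp only [Sum.elim_inl, Sum.elim_inr]
      omega
  · obtain ⟨X, Y, h⟩ := exists_isPairLabeling q p hq hpq
    have h' := h.isPathLabeling.comp Sum.swap Sum.swap_leftInverse.injective
    refine ⟨(Sum.elim (fun _ => X) fun _ => Y) ∘ Sum.swap, ?_, ?_, Or.inr ?_⟩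
    · rw [add_comm p q]
      convert h' using 1
      funext i
      rcases i with _ | _ <;> rfl
    · rintro (_ | _) t ht
      · have := h.right_sum_le t ht
        simp only [Function.comp_apply, Sum.swap_inl, Sum.elim_inr]
        omega
      · have := h.left_sum_le t ht
        simp only [Function.comp_apply, Sum.swap_inr, Sum.elim_inl]
        omega
    · have := h.left_zero
      have := h.left_last
      have := h.right_zero
      have := h.right_last
      simp only [Function.comp_apply, Sum.swap_inr, Sum.swap_inl, Sum.elim_inl, Sum.elim_inr]
      omega

/-! ### Distributing the labels over the whole spider -/

/-- The two families of cycles and the path of a cycle double spider without the path: every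
consecutive sum is small compared with the ends of the first cycle of each family, and the other
cycles of the first family have larger end sums than those of the second family. -/
theorem exists_isPathLabeling_cycles {a b : ℕ} (p : Fin (a + 1) → ℕ) (q : Fin (b + 1) → ℕ)
    (hp : ∀ i, 3 ≤ p i) (hq : ∀ j, 3 ≤ q j) {N : ℕ} (hN : N = ∑ i, p i + ∑ j, q j) :
    ∃ (L : Fin (a + 1) ⊕ Fin (b + 1) → ℕ → ℕ) (K : ℕ), IsPathLabeling (Sum.elim p q) N L ∧
      (∀ i t, t + 1 < Sum.elim p q i → L i t + L i (t + 1) + 4 ≤ 2 * N) ∧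
      (∀ i : Fin a, 2 * K + 5 ≤ L (.inl i.succ) 0 + L (.inl i.succ) (p i.succ - 1)) ∧
      (∀ j : Fin b, L (.inr j.succ) 0 + L (.inr j.succ) (q j.succ - 1) + 1 ≤ 2 * K) ∧
      (L (.inl 0) 0 + L (.inl 0) (p 0 - 1) + 1 = 2 * N ∧
          L (.inr 0) 0 + L (.inr 0) (q 0 - 1) + 5 = 2 * N ∨
        L (.inl 0) 0 + L (.inl 0) (p 0 - 1) + 5 = 2 * N ∧
          L (.inr 0) 0 + L (.inr 0) (q 0 - 1) + 1 = 2 * N) := by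
  obtain ⟨U, hU, hU'⟩ := exists_isPathLabeling_fin (fun i : Fin a => p i.succ)
    (fun i => (Nat.le_succ 2).trans (hp _))
  obtain ⟨W, hW, hW'⟩ := exists_isPathLabeling_fin (fun j : Fin b => q j.succ)
    (fun j => (Nat.le_succ 2).trans (hq _))
  obtain ⟨D, hD, hDs, hD'⟩ := exists_isPathLabeling_pair (p 0) (q 0) (hp 0) (hq 0)
  rw [Fin.sum_univ_succ p, Fin.sum_univ_succ q] at hN
  set A := ∑ i : Fin a, p i.succ
  set B := ∑ j : Fin b, q j.succ
  -- The nesting of the sum type is the order of the label intervals: remaining cycles of `q`,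
  -- remaining cycles of `p`, then the chosen pair.
  let g : Fin (a + 1) ⊕ Fin (b + 1) → (Fin b ⊕ Fin a) ⊕ (Unit ⊕ Unit) :=
    Sum.elim (Fin.cases (.inr (.inl ())) fun i => .inl (.inr i))
      (Fin.cases (.inr (.inr ())) fun j => .inl (.inl j))
  have hg : Function.Injective g := by
    rintro (i | i) (j | j) <;> refine Fin.cases ?_ (fun i => ?_) i <;>
      refine Fin.cases ?_ (fun j => ?_) j <;> simp [g]
  have h := ((hW.sum hU).sum hD).comp g hg
  have hlen : Sum.elim (Sum.elim (fun j : Fin b => q j.succ) fun i : Fin a => p i.succ)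
      (Sum.elim (fun _ : Unit => p 0) fun _ : Unit => q 0) ∘ g = Sum.elim p q := by
    funext i
    rcases i with i | i <;> refine Fin.cases ?_ (fun i => ?_) i <;> rfl
  rw [hlen] at h
  have hp0 := hp 0
  have hq0 := hq 0
  -- The remaining cycles of `q` use the labels up to `B`, so their end sums are at most `2B - 1`.
  -- Those of `p` are raised by `B`, and a length of at least 3 gives end sums of at least `2 * 3 -
  -- 1` before raising.
  refine ⟨_, B, by convert h using 1; omega, ?_, fun i => ?_, fun j => ?_, ?_⟩
  · rintro (i | i) t <;> refine Fin.cases ?_ (fun i => ?_) i <;> intro ht <;>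
      simp only [Function.comp_apply, g, Sum.elim_inl, Sum.elim_inr, Fin.cases_zero,
        Fin.cases_succ] at ht ⊢
    · have := hDs (.inl ()) t ht
      omega
    · have := hU.sum_lt i t ht
      omega
    · have := hDs (.inr ()) t ht
      omega
    · have := hW.sum_lt i t ht
      omega
  · have := hU' i
    have := hp i.succ
    simp only [Function.comp_apply, g, Sum.elim_inl, Sum.elim_inr, Fin.cases_succ]
    omega
  · have := hW' j
    simp only [Function.comp_apply, g, Sum.elim_inl, Sum.elim_inr, Fin.cases_succ]
    omega
  · simp only [Function.comp_apply, g, Sum.elim_inl, Sum.elim_inr, Fin.cases_zero]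
    omega

/-- A labelling of the edges of a cycle double spider, given by the labels along the path and
along the cycles, which is strongly antimagic. -/
structure IsSpiderLabeling (x : ℕ) {a b : ℕ} (p : Fin a → ℕ) (q : Fin b → ℕ) (P : ℕ → ℕ)
    (L : Fin a → ℕ → ℕ) (R : Fin b → ℕ → ℕ) : Prop where
  isPathLabeling : IsPathLabeling (Sum.elim (fun _ : Unit => x) (Sum.elim p q))
    (x + (∑ i, p i + ∑ j, q j)) (Sum.elim (fun _ => P) (Sum.elim L R))
  lt_left : ∀ i t, t + 1 < Sum.elim (fun _ : Unit => x) (Sum.elim p q) i →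
    Sum.elim (fun _ => P) (Sum.elim L R) i t + Sum.elim (fun _ => P) (Sum.elim L R) i (t + 1) <
      P 0 + ∑ i, (L i 0 + L i (p i - 1))
  lt_right : ∀ i t, t + 1 < Sum.elim (fun _ : Unit => x) (Sum.elim p q) i →
    Sum.elim (fun _ => P) (Sum.elim L R) i t + Sum.elim (fun _ => P) (Sum.elim L R) i (t + 1) <
      P (x - 1) + ∑ j, (R j 0 + R j (q j - 1))
  ne : P 0 + ∑ i, (L i 0 + L i (p i - 1)) ≠ P (x - 1) + ∑ j, (R j 0 + R j (q j - 1))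
  right_lt_left : b < a →
    P (x - 1) + ∑ j, (R j 0 + R j (q j - 1)) < P 0 + ∑ i, (L i 0 + L i (p i - 1))
  left_lt_right : a < b →
    P 0 + ∑ i, (L i 0 + L i (p i - 1)) < P (x - 1) + ∑ j, (R j 0 + R j (q j - 1))

/-- Exchanging the hubs reverses the central path; this justifies assuming `b ≤ a`. -/
theorem IsSpiderLabeling.symm {x a b : ℕ} {p : Fin a → ℕ} {q : Fin b → ℕ} {P : ℕ → ℕ}
    {L : Fin a → ℕ → ℕ} {R : Fin b → ℕ → ℕ} (h : IsSpiderLabeling x p q P L R) :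
    IsSpiderLabeling x q p (fun t => P (x - 1 - t)) R L := by
  have hsum : ∀ t, t + 1 < x → ∃ s, s + 1 < x ∧ t = x - 2 - s ∧
      P (x - 1 - t) + P (x - 1 - (t + 1)) = P s + P (s + 1) := by
    intro t ht
    refine ⟨x - 2 - t, by omega, by omega, ?_⟩
    rw [show x - 2 - t + 1 = x - 1 - t by omega, show x - 1 - (t + 1) = x - 2 - t by omega,
      add_comm]
  have hH := h.isPathLabeling
  constructor
  · constructor
    · rintro (i | i | i) t ht
      · exact hH.pos (.inl i) (x - 1 - t) (by simp only [Sum.elim_inl] at ht ⊢; omega)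
      · exact hH.pos (.inr (.inr i)) t ht
      · exact hH.pos (.inr (.inl i)) t ht
    · rw [add_comm (∑ i, q i)]
      rintro (i | i | i) t ht
      · exact hH.le (.inl i) (x - 1 - t) (by simp only [Sum.elim_inl] at ht ⊢; omega)
      · exact hH.le (.inr (.inr i)) t ht
      · exact hH.le (.inr (.inl i)) t ht
    · rintro (i | i | i) (j | j | j) s t hs ht e
      all_goals simp only [Sum.elim_inl, Sum.elim_inr] at hs ht e
      · have := (hH.inj (.inl i) (.inl j) (x - 1 - s) (x - 1 - t)
          (by simp only [Sum.elim_inl]; omega) (by simp only [Sum.elim_inl]; omega) e).2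
        exact ⟨rfl, by omega⟩
      · simpa using hH.inj (.inl i) (.inr (.inr j)) (x - 1 - s) t
          (by simp only [Sum.elim_inl]; omega) ht e
      · simpa using hH.inj (.inl i) (.inr (.inl j)) (x - 1 - s) t
          (by simp only [Sum.elim_inl]; omega) ht e
      · simpa using hH.inj (.inr (.inr i)) (.inl j) s (x - 1 - t) hs
          (by simp only [Sum.elim_inl]; omega) e
      · simpa using hH.inj (.inr (.inr i)) (.inr (.inr j)) s t hs ht e
      · simpa using hH.inj (.inr (.inr i)) (.inr (.inl j)) s t hs ht e
      · simpa using hH.inj (.inr (.inl i)) (.inl j) s (x - 1 - t) hs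
          (by simp only [Sum.elim_inl]; omega) e
      · simpa using hH.inj (.inr (.inl i)) (.inr (.inr j)) s t hs ht e
      · simpa using hH.inj (.inr (.inl i)) (.inr (.inl j)) s t hs ht e
    · rintro (i | i | i) (j | j | j) s t hs ht e
      all_goals simp only [Sum.elim_inl, Sum.elim_inr] at hs ht e
      · obtain ⟨s', hs', rfl, es⟩ := hsum s hs
        obtain ⟨t', ht', rfl, et⟩ := hsum t ht
        rw [es, et] at e
        have := (hH.sum_inj (.inl i) (.inl j) s' t' hs' ht' e).2
        exact ⟨rfl, by omega⟩
      · obtain ⟨s', hs', rfl, es⟩ := hsum s hs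
        rw [es] at e
        simpa using hH.sum_inj (.inl i) (.inr (.inr j)) s' t hs' ht e
      · obtain ⟨s', hs', rfl, es⟩ := hsum s hs
        rw [es] at e
        simpa using hH.sum_inj (.inl i) (.inr (.inl j)) s' t hs' ht e
      · obtain ⟨t', ht', rfl, et⟩ := hsum t ht
        rw [et] at e
        simpa using hH.sum_inj (.inr (.inr i)) (.inl j) s t' hs ht' e
      · simpa using hH.sum_inj (.inr (.inr i)) (.inr (.inr j)) s t hs ht e
      · simpa using hH.sum_inj (.inr (.inr i)) (.inr (.inl j)) s t hs ht e
      · obtain ⟨t', ht', rfl, et⟩ := hsum t ht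
        rw [et] at e
        simpa using hH.sum_inj (.inr (.inl i)) (.inl j) s t' hs ht' e
      · simpa using hH.sum_inj (.inr (.inl i)) (.inr (.inr j)) s t hs ht e
      · simpa using hH.sum_inj (.inr (.inl i)) (.inr (.inl j)) s t hs ht e
  · rintro (i | i | i) t ht
    · obtain ⟨s, hs, -, es⟩ := hsum t ht
      simpa [es] using h.lt_right (.inl i) s hs
    · simpa using h.lt_right (.inr (.inr i)) t ht
    · simpa using h.lt_right (.inr (.inl i)) t ht
  · rintro (i | i | i) t ht
    · obtain ⟨s, hs, -, es⟩ := hsum t ht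
      simpa [es] using h.lt_left (.inl i) s hs
    · simpa using h.lt_left (.inr (.inr i)) t ht
    · simpa using h.lt_left (.inr (.inl i)) t ht
  · simpa using h.ne.symm
  · simpa using h.left_lt_right
  · simpa using h.right_lt_left

/-- If `a = 0` only the chosen cycles are present and `hne` decides. Otherwise the remaining cycles
put the first hub ahead by at least `5 * a`, more than the deficit of 4 allowed by `hle`. -/
theorem isSpiderLabeling_of_bounds {x a b : ℕ} {p : Fin (a + 1) → ℕ} {q : Fin (b + 1) → ℕ}
    {P : ℕ → ℕ} {L : Fin (a + 1) → ℕ → ℕ} {R : Fin (b + 1) → ℕ → ℕ} (hab : b ≤ a)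
    (hP : IsPathLabeling (Sum.elim (fun _ : Unit => x) (Sum.elim p q))
      (x + (∑ i, p i + ∑ j, q j)) (Sum.elim (fun _ => P) (Sum.elim L R)))
    (K : ℕ) (hK : ∀ i : Fin a, 2 * K + 5 ≤ L i.succ 0 + L i.succ (p i.succ - 1))
    (hK' : ∀ j : Fin b, R j.succ 0 + R j.succ (q j.succ - 1) + 1 ≤ 2 * K)
    (hl : ∀ i t, t + 1 < Sum.elim (fun _ : Unit => x) (Sum.elim p q) i →
      Sum.elim (fun _ => P) (Sum.elim L R) i t + Sum.elim (fun _ => P) (Sum.elim L R) i (t + 1) <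
      P 0 + (L 0 0 + L 0 (p 0 - 1)))
    (hr : ∀ i t, t + 1 < Sum.elim (fun _ : Unit => x) (Sum.elim p q) i →
      Sum.elim (fun _ => P) (Sum.elim L R) i t + Sum.elim (fun _ => P) (Sum.elim L R) i (t + 1) <
      P (x - 1) + (R 0 0 + R 0 (q 0 - 1)))
    (hne : P 0 + (L 0 0 + L 0 (p 0 - 1)) ≠ P (x - 1) + (R 0 0 + R 0 (q 0 - 1)))
    (hle : P (x - 1) + (R 0 0 + R 0 (q 0 - 1)) ≤ P 0 + (L 0 0 + L 0 (p 0 - 1)) + 4) :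
    IsSpiderLabeling x p q P L R := by
  have h1 : a * (2 * K + 5) ≤ ∑ i : Fin a, (L i.succ 0 + L i.succ (p i.succ - 1)) := by
    simpa using Finset.card_nsmul_le_sum Finset.univ
      (fun i : Fin a => L i.succ 0 + L i.succ (p i.succ - 1)) _ (fun i _ => hK i)
  have h2 : ∑ j : Fin b, (R j.succ 0 + R j.succ (q j.succ - 1)) ≤ b * (2 * K) := by
    simpa using Finset.sum_le_card_nsmul Finset.univ
      (fun j : Fin b => R j.succ 0 + R j.succ (q j.succ - 1)) _
      (fun j _ => (Nat.le_succ _).trans (hK' j))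
  have h3 : b * (2 * K) ≤ a * (2 * K) := Nat.mul_le_mul_right _ hab
  rw [Nat.mul_add] at h1
  have h4 : a = 0 → ∑ i : Fin a, (L i.succ 0 + L i.succ (p i.succ - 1)) = 0 := by
    rintro rfl; simp
  have h5 : b = 0 → ∑ j : Fin b, (R j.succ 0 + R j.succ (q j.succ - 1)) = 0 := by
    rintro rfl; simp
  refine ⟨hP, fun i t ht => ?_, fun i t ht => ?_, ?_, fun h => ?_, fun h => by omega⟩
  · have := hl i t ht
    rw [Fin.sum_univ_succ]
    omega
  · have := hr i t ht
    rw [Fin.sum_univ_succ]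
    omega
  · rw [Fin.sum_univ_succ, Fin.sum_univ_succ]
    omega
  · rw [Fin.sum_univ_succ, Fin.sum_univ_succ]
    omega

theorem isPathLabeling_pathLabel_reverse (p : ℕ) :
    IsPathLabeling (fun _ : Unit => p) p (fun _ t => pathLabel p (p - 1 - t)) where
  pos _ t ht := by unfold pathLabel; split_ifs <;> omega
  le _ t ht := by unfold pathLabel; split_ifs <;> omega
  inj _ _ s t hs ht e := by
    refine ⟨rfl, ?_⟩
    unfold pathLabel at e; split_ifs at e <;> omega
  sum_inj _ _ s t hs ht e := by
    refine ⟨rfl, ?_⟩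
    unfold pathLabel at e; split_ifs at e <;> omega

theorem exists_isSpiderLabeling_of_le {x a b : ℕ} (p : Fin (a + 1) → ℕ) (q : Fin (b + 1) → ℕ)
    (hx : 1 ≤ x) (hp : ∀ i, 3 ≤ p i) (hq : ∀ j, 3 ≤ q j) (hab : b ≤ a) :
    ∃ P L R, IsSpiderLabeling x p q P L R := by
  obtain ⟨F, K, hF, hs, hK, hK', hD⟩ := exists_isPathLabeling_cycles p q hp hq rfl
  have hN : 3 ≤ ∑ i, p i :=
    (hp 0).trans (Finset.single_le_sum (f := p) (fun _ _ => Nat.zero_le _) (Finset.mem_univ 0))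
  set N := ∑ i, p i + ∑ j, q j
  -- A single edge labelled 1 could leave a hub sum equal to a consecutive sum. Labelled `N + 1`, it
  -- adds the same large amount to both hubs, whose chosen cycles differ by 4.
  by_cases hx1 : x = 1
  · subst hx1
    have h := (hF.sum (isPathLabeling_pathLabel 1)).comp Sum.swap Sum.swap_leftInverse.injective
    have h0 : pathLabel 1 0 = 1 := rfl
    have hlt : ∀ i t, t + 1 < Sum.elim (fun _ : Unit => 1) (Sum.elim p q) i →
        Sum.elim (fun (_ : Unit) t => N + pathLabel 1 t)
          (Sum.elim (fun i => F (.inl i)) fun j => F (.inr j)) i t +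
        Sum.elim (fun (_ : Unit) t => N + pathLabel 1 t)
          (Sum.elim (fun i => F (.inl i)) fun j => F (.inr j)) i (t + 1) + 4 ≤ 2 * N := by
      rintro (i | i | i) t ht
      · simp at ht
      · exact hs (.inl i) t ht
      · exact hs (.inr i) t ht
    refine ⟨fun t => N + pathLabel 1 t, fun i => F (.inl i), fun j => F (.inr j),
      isSpiderLabeling_of_bounds hab ?_ K hK hK' ?_ ?_ ?_ ?_⟩
    · convert h using 1
      · funext i; rcases i with i | i | i <;> rfl
      · omega
      · funext i; rcases i with i | i | i <;> rfl
    · intro i t ht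
      have := hlt i t ht
      omega
    · intro i t ht
      have := hlt i t ht
      simp only [Nat.sub_self]
      omega
    · simp only [Nat.sub_self]
      omega
    · simp only [Nat.sub_self]
      omega
  -- The end labelled `x` goes to the hub whose chosen cycle has the smaller end sum. With `x - 1`
  -- there, the case `x = 2` would only give equality with the bound on consecutive sums. The two
  -- hubs then differ by 3 before the remaining cycles are counted.
  · obtain ⟨P, hP, hP1, hP2⟩ : ∃ P : ℕ → ℕ, IsPathLabeling (fun _ : Unit => x) x (fun _ => P) ∧
        (P 0 = x ∧ P (x - 1) + 1 = x ∨ P (x - 1) = x ∧ P 0 + 1 = x) ∧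
        (P 0 = x → F (.inl 0) 0 + F (.inl 0) (p 0 - 1) + 5 = 2 * N ∧
          F (.inr 0) 0 + F (.inr 0) (q 0 - 1) + 1 = 2 * N) ∧
        (P (x - 1) = x → F (.inl 0) 0 + F (.inl 0) (p 0 - 1) + 1 = 2 * N ∧
          F (.inr 0) 0 + F (.inr 0) (q 0 - 1) + 5 = 2 * N) := by
      have h1 := pathLabel_zero hx
      have h2 := pathLabel_last (p := x) (by omega)
      rcases hD with hD | hD
      · refine ⟨_, isPathLabeling_pathLabel_reverse x, ?_⟩
        simp only [Nat.sub_self, Nat.sub_zero]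
        omega
      · refine ⟨_, isPathLabeling_pathLabel x, ?_⟩
        omega
    have h := hP.sum hF
    have hlt : ∀ i t, t + 1 < Sum.elim (fun _ : Unit => x) (Sum.elim p q) i →
        Sum.elim (fun _ : Unit => P)
          (Sum.elim (fun i t => x + F (.inl i) t) fun j t => x + F (.inr j) t) i t +
        Sum.elim (fun _ : Unit => P)
          (Sum.elim (fun i t => x + F (.inl i) t) fun j t => x + F (.inr j) t) i (t + 1) + 4 ≤
        2 * N + 2 * x := by
      rintro (i | i | i) t ht
      · have := hP.sum_lt i t ht
        simp only [Sum.elim_inl]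
        omega
      · have := hs (.inl i) t ht
        simp only [Sum.elim_inl, Sum.elim_inr]
        omega
      · have := hs (.inr i) t ht
        simp only [Sum.elim_inr]
        omega
    refine ⟨P, fun i t => x + F (.inl i) t, fun j t => x + F (.inr j) t,
      isSpiderLabeling_of_bounds hab ?_ (K + x) (fun i => ?_) (fun j => ?_) ?_ ?_ ?_ ?_⟩
    · convert h using 1
      funext i; rcases i with i | i | i <;> rfl
    · have := hK i
      omega
    · have := hK' j
      omega
    · intro i t ht
      have := hlt i t ht
      omega
    · intro i t ht
      have := hlt i t ht
      omega
    · omega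
    · omega

theorem exists_isSpiderLabeling {x a b : ℕ} (p : Fin a → ℕ) (q : Fin b → ℕ) (hx : 1 ≤ x)
    (ha : 1 ≤ a) (hb : 1 ≤ b) (hp : ∀ i, 3 ≤ p i) (hq : ∀ j, 3 ≤ q j) :
    ∃ P L R, IsSpiderLabeling x p q P L R := by
  obtain ⟨a, rfl⟩ : ∃ c, a = c + 1 := ⟨a - 1, by omega⟩
  obtain ⟨b, rfl⟩ : ∃ c, b = c + 1 := ⟨b - 1, by omega⟩
  rcases le_total b a with hab | hab
  · exact exists_isSpiderLabeling_of_le p q hx hp hq hab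
  · obtain ⟨P, L, R, h⟩ := exists_isSpiderLabeling_of_le q p hx hq hp hab
    exact ⟨_, _, _, h.symm⟩

/-! ### Antimagic labelings through indexed edges -/

open Classical in
/-- The sum of the weights `w e` over the edges `e` that contain `v`, for edges indexed by `E`. -/
noncomputable def incidenceSum {V E : Type*} [Fintype E] (ends : E → Sym2 V) (w : E → ℕ) (v : V) :
    ℕ :=
  ∑ e, if v ∈ ends e then w e else 0

theorem incidenceSum_map {V W E : Type*} [Fintype E] (ends : E → Sym2 V) (w : E → ℕ) (g : V ≃ W)
    (v : W) :
    incidenceSum (fun e => (ends e).map g) w v = incidenceSum ends w (g.symm v) := by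
  unfold incidenceSum
  refine Finset.sum_congr rfl fun e _ => ?_
  congr 1
  rw [Sym2.mem_map, eq_iff_iff]
  constructor
  · rintro ⟨u, hu, rfl⟩
    simpa using hu
  · exact fun h => ⟨_, h, by simp⟩

theorem isStronglyAntimagic_of_incidenceSum {V E : Type*} [Fintype V] [DecidableEq V] [Fintype E]
    (G : SimpleGraph V) [DecidableRel G.Adj] (ends : E → Sym2 V)
    (hinj : Function.Injective ends) (hrange : ∀ s, s ∈ G.edgeSet ↔ ∃ e, ends e = s)
    (lab : E → ℕ) (hlab : Function.Injective lab)
    (hmem : ∀ e, 1 ≤ lab e ∧ lab e ≤ Fintype.card E)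
    (hne : ∀ u v, u ≠ v → incidenceSum ends lab u ≠ incidenceSum ends lab v)
    (hlt : ∀ u v, incidenceSum ends (fun _ => 1) v < incidenceSum ends (fun _ => 1) u →
      incidenceSum ends lab v < incidenceSum ends lab u) :
    IsStronglyAntimagic G := by
  classical
  have hedge : G.edgeFinset = Finset.univ.image ends := by
    ext s; simp [hrange]
  have hcard : G.edgeFinset.card = Fintype.card E := by
    rw [hedge, Finset.card_image_of_injective _ hinj, Finset.card_univ]
  have hinc : ∀ v, G.incidenceFinset v = (Finset.univ.filter fun e => v ∈ ends e).image ends := by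
    intro v
    ext s
    simp only [SimpleGraph.mem_incidenceFinset, SimpleGraph.incidenceSet, Set.mem_ofPred_eq, hrange,
      Finset.mem_image, Finset.mem_filter, Finset.mem_univ, true_and]
    constructor
    · rintro ⟨⟨e, rfl⟩, h⟩
      exact ⟨e, h, rfl⟩
    · rintro ⟨e, h, rfl⟩
      exact ⟨⟨e, rfl⟩, h⟩
  have hsum : ∀ (f : Sym2 V → ℕ) v,
      ∑ s ∈ G.incidenceFinset v, f s = incidenceSum ends (f ∘ ends) v := by
    intro f v
    rw [hinc, Finset.sum_image hinj.injOn, Finset.sum_filter]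
    unfold incidenceSum
    exact Finset.sum_congr rfl fun e _ => by congr
  have hdeg : ∀ v, G.degree v = incidenceSum ends (fun _ => 1) v := by
    intro v
    rw [← G.card_incidenceFinset_eq_degree, Finset.card_eq_sum_ones, hsum]
    rfl
  let f : Sym2 V → ℕ := Function.extend ends lab 0
  have hf : ∀ e, f (ends e) = lab e := hinj.extend_apply lab 0
  have hfe : f ∘ ends = lab := funext hf
  have hv : ∀ v, vertexSum G f v = incidenceSum ends lab v := by
    intro v
    rw [vertexSum, hsum, hfe]
  refine ⟨f, ⟨⟨?_, ?_, ?_⟩, ?_⟩, ?_⟩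
  · intro s hs
    obtain ⟨e, rfl⟩ := (hrange s).1 hs
    rw [hf, hcard]
    exact hmem e
  · intro s hs t ht h
    obtain ⟨e, rfl⟩ := (hrange s).1 hs
    obtain ⟨e', rfl⟩ := (hrange t).1 ht
    rw [hf, hf] at h
    rw [hlab h]
  -- Surjectivity by counting: an injection into a set of the same size.
  · have himage : Finset.univ.image lab = Finset.Icc 1 (Fintype.card E) := by
      apply Finset.eq_of_subset_of_card_le
      · intro k hk
        obtain ⟨e, -, rfl⟩ := Finset.mem_image.1 hk
        exact Finset.mem_Icc.2 (hmem e)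
      · rw [Finset.card_image_of_injective _ hlab, Finset.card_univ, Nat.card_Icc]
        omega
    intro k hk
    rw [hcard, ← Finset.coe_Icc, ← himage] at hk
    obtain ⟨e, -, rfl⟩ := Finset.mem_image.1 hk
    exact ⟨ends e, (hrange _).2 ⟨e, rfl⟩, hf e⟩
  · intro u v huv
    rw [hv, hv]
    exact hne u v huv
  · intro u v huv
    rw [hv, hv]
    rw [hdeg, hdeg] at huv
    exact hlt u v huv

/-! ### The edges of the spider as steps of walks -/

namespace CDSVertex

variable {x a b : ℕ} {p : Fin a → ℕ} {q : Fin b → ℕ}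

/-- The numbers of edges of the path and of the cycles of a cycle double spider. -/
def len (x : ℕ) {a b : ℕ} (p : Fin a → ℕ) (q : Fin b → ℕ) : Unit ⊕ (Fin a ⊕ Fin b) → ℕ :=
  Sum.elim (fun _ => x) (Sum.elim p q)

/-- The vertices met when walking along the path, or around a cycle from its hub to its hub. -/
def walk (x : ℕ) {a b : ℕ} (p : Fin a → ℕ) (q : Fin b → ℕ) :
    Unit ⊕ (Fin a ⊕ Fin b) → ℕ → CDSVertex x p q
  | .inl _, k => .mid ⟨min k x, by omega⟩
  | .inr (.inl i), k => if h : 1 ≤ k ∧ k < p i then .left i ⟨k - 1, by omega⟩ else .mid 0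
  | .inr (.inr j), k => if h : 1 ≤ k ∧ k < q j then .right j ⟨k - 1, by omega⟩ else
      .mid (Fin.last x)

/-- The edges of a cycle double spider, indexed by their places on the path and the cycles. -/
def ends (x : ℕ) {a b : ℕ} (p : Fin a → ℕ) (q : Fin b → ℕ) (e : Σ i, Fin (len x p q i)) :
    Sym2 (CDSVertex x p q) :=
  s(walk x p q e.1 e.2, walk x p q e.1 (e.2 + 1))

theorem walk_path_eq_walk_path {k l : ℕ} (hk : k ≤ x) (hl : l ≤ x)
    (h : walk x p q (.inl ()) k = walk x p q (.inl ()) l) : k = l := by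
  simp [walk, Fin.ext_iff] at h
  omega

/-- Distinct places can share a vertex only when both are extremes of their walks, that is, at a
hub. -/
theorem walk_eq_walk {i j : Unit ⊕ (Fin a ⊕ Fin b)} {k l : ℕ} (hk : k ≤ len x p q i)
    (hl : l ≤ len x p q j) (h : walk x p q i k = walk x p q j l) :
    i = j ∧ k = l ∨ (k = 0 ∨ k = len x p q i) ∧ (l = 0 ∨ l = len x p q j) := by
  rcases i with i | i | i <;> rcases j with j | j | j <;>
    simp only [len, Sum.elim_inl, Sum.elim_inr, walk] at hk hl h ⊢
  · exact Or.inl ⟨trivial, walk_path_eq_walk_path (p := p) (q := q) hk hl h⟩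
  all_goals
    split_ifs at h <;>
    first
    | exact Or.inr ⟨by omega, by omega⟩
    | cases h
    | (simp only [mid.injEq, left.injEq, right.injEq] at h
       first
       | (rw [Fin.ext_iff] at h
          try simp only [Fin.val_zero, Fin.val_last] at h
          first | exact Or.inl ⟨rfl, by omega⟩ | exact Or.inr ⟨by omega, by omega⟩)
       | (obtain ⟨rfl, h⟩ := h
          have := Fin.ext_iff.1 (eq_of_heq h)
          simp only at this
          exact Or.inl ⟨rfl, by omega⟩))

theorem eq_path_of_len_le_two (hp : ∀ i, 3 ≤ p i) (hq : ∀ j, 3 ≤ q j)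
    {i : Unit ⊕ (Fin a ⊕ Fin b)} (h : len x p q i ≤ 2) : i = .inl () := by
  rcases i with i | i | i
  · rfl
  · exact absurd ((hp i).trans h) (by omega)
  · exact absurd ((hq i).trans h) (by omega)

/-- A coincidence between different edges would force a walk of at most two edges between extremes.
Cycles are too long for that, and the central path never revisits a vertex. -/
theorem ends_injective (hp : ∀ i, 3 ≤ p i) (hq : ∀ j, 3 ≤ q j) :
    Function.Injective (ends x p q) := by
  have key : ∀ {i}, len x p q i ≤ 2 → i = .inl () := eq_path_of_len_le_two hp hq
  rintro ⟨i, s, hs⟩ ⟨j, t, ht⟩ h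
  suffices i = j ∧ s = t by
    obtain ⟨rfl, rfl⟩ := this
    rfl
  rcases Sym2.eq_iff.1 h with ⟨h1, h2⟩ | ⟨h1, h2⟩ <;> dsimp only at h1 h2
  · rcases walk_eq_walk hs.le ht.le h1 with h3 | h3
    · exact h3
    rcases walk_eq_walk hs ht h2 with h4 | h4
    · exact ⟨h4.1, by omega⟩
    · have hi := key (i := i) (by omega)
      have hj := key (i := j) (by omega)
      exact ⟨hi.trans hj.symm, by omega⟩
  · exfalso
    rcases walk_eq_walk hs.le ht h1 with ⟨rfl, h3⟩ | h3 <;>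
    rcases walk_eq_walk hs ht.le h2 with ⟨h4, h5⟩ | h4
    · omega
    · obtain rfl := key (i := i) (by omega)
      have := walk_path_eq_walk_path hs ht.le h2
      omega
    · subst h4
      obtain rfl := key (i := i) (by omega)
      have := walk_path_eq_walk_path hs.le ht h1
      omega
    · obtain rfl := key (i := i) (by omega)
      obtain rfl := key (i := j) (by omega)
      have := walk_path_eq_walk_path hs.le ht h1
      omega

theorem exists_ends_of_edge (hp : ∀ i, 3 ≤ p i) (hq : ∀ j, 3 ≤ q j) {u v : CDSVertex x p q}
    (h : CDSEdge x p q u v) : ∃ e, ends x p q e = s(u, v) := by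
  cases h with
  | mid s t h =>
    refine ⟨⟨.inl (), ⟨s, by have := t.2; simp only [len, Sum.elim_inl]; omega⟩⟩, ?_⟩
    have h1 : min s.val x = s := by omega
    have h2 : min (s.val + 1) x = t := by omega
    simp [ends, walk, h1, h2]
  | left i s t h =>
    have := t.2
    refine ⟨⟨.inr (.inl i), ⟨t, by simp only [len, Sum.elim_inl, Sum.elim_inr]; omega⟩⟩, ?_⟩
    have h1 : 1 ≤ t.val ∧ t.val < p i := by omega
    have h2 : 1 ≤ t.val + 1 ∧ t.val + 1 < p i := by omega
    have h3 : t.val - 1 = s := by omega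
    simp only [ends, walk, dif_pos h1, dif_pos h2, h3, Nat.add_sub_cancel]
  | right i s t h =>
    have := t.2
    refine ⟨⟨.inr (.inr i), ⟨t, by simp only [len, Sum.elim_inr]; omega⟩⟩, ?_⟩
    have h1 : 1 ≤ t.val ∧ t.val < q i := by omega
    have h2 : 1 ≤ t.val + 1 ∧ t.val + 1 < q i := by omega
    have h3 : t.val - 1 = s := by omega
    simp only [ends, walk, dif_pos h1, dif_pos h2, h3, Nat.add_sub_cancel]
  | leftFirst i t h =>
    have := hp i
    refine ⟨⟨.inr (.inl i), ⟨t, by simp only [len, Sum.elim_inl, Sum.elim_inr]; omega⟩⟩, ?_⟩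
    have h1 : ¬ (1 ≤ t.val ∧ t.val < p i) := by omega
    have h2 : 1 ≤ t.val + 1 ∧ t.val + 1 < p i := by omega
    simp only [ends, walk, dif_neg h1, dif_pos h2, Nat.add_sub_cancel]
  | leftLast i t h =>
    have := hp i
    refine ⟨⟨.inr (.inl i), ⟨t + 1, by simp only [len, Sum.elim_inl, Sum.elim_inr]; omega⟩⟩, ?_⟩
    have h1 : 1 ≤ t.val + 1 ∧ t.val + 1 < p i := by omega
    have h2 : ¬ (1 ≤ t.val + 1 + 1 ∧ t.val + 1 + 1 < p i) := by omega
    simp only [ends, walk, dif_neg h2, dif_pos h1, Nat.add_sub_cancel]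
    exact Sym2.eq_swap
  | rightFirst i t h =>
    have := hq i
    refine ⟨⟨.inr (.inr i), ⟨t, by simp only [len, Sum.elim_inr]; omega⟩⟩, ?_⟩
    have h1 : ¬ (1 ≤ t.val ∧ t.val < q i) := by omega
    have h2 : 1 ≤ t.val + 1 ∧ t.val + 1 < q i := by omega
    simp only [ends, walk, dif_neg h1, dif_pos h2, Nat.add_sub_cancel]
  | rightLast i t h =>
    have := hq i
    refine ⟨⟨.inr (.inr i), ⟨t + 1, by simp only [len, Sum.elim_inr]; omega⟩⟩, ?_⟩
    have h1 : 1 ≤ t.val + 1 ∧ t.val + 1 < q i := by omega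
    have h2 : ¬ (1 ≤ t.val + 1 + 1 ∧ t.val + 1 + 1 < q i) := by omega
    simp only [ends, walk, dif_neg h2, dif_pos h1, Nat.add_sub_cancel]
    exact Sym2.eq_swap

theorem adj_walk (hp : ∀ i, 3 ≤ p i) (hq : ∀ j, 3 ≤ q j) (i : Unit ⊕ (Fin a ⊕ Fin b)) (t : ℕ)
    (ht : t < len x p q i) :
    (cycleDoubleSpider x p q).Adj (walk x p q i t) (walk x p q i (t + 1)) := by
  rw [cycleDoubleSpider, SimpleGraph.fromRel_adj]
  rcases i with i | i | i <;> simp only [len, Sum.elim_inl, Sum.elim_inr] at ht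
  · refine ⟨fun h => ?_, Or.inl (CDSEdge.mid _ _ ?_)⟩
    · have := walk_path_eq_walk_path ht.le ht h
      omega
    · simp only
      omega
  · have hi := hp i
    by_cases h1 : 1 ≤ t ∧ t < p i <;> by_cases h2 : 1 ≤ t + 1 ∧ t + 1 < p i
    · simp only [walk, dif_pos h1, dif_pos h2]
      refine ⟨fun h => ?_, Or.inl (CDSEdge.left _ _ _ ?_)⟩
      · simp at h
        omega
      · simp only
        omega
    · simp only [walk, dif_pos h1, dif_neg h2]
      exact ⟨nofun, Or.inr (CDSEdge.leftLast _ _ (by simp only; omega))⟩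
    · simp only [walk, dif_neg h1, dif_pos h2]
      exact ⟨nofun, Or.inl (CDSEdge.leftFirst _ _ (by simp only; omega))⟩
    · omega
  · have hi := hq i
    by_cases h1 : 1 ≤ t ∧ t < q i <;> by_cases h2 : 1 ≤ t + 1 ∧ t + 1 < q i
    · simp only [walk, dif_pos h1, dif_pos h2]
      refine ⟨fun h => ?_, Or.inl (CDSEdge.right _ _ _ ?_)⟩
      · simp at h
        omega
      · simp only
        omega
    · simp only [walk, dif_pos h1, dif_neg h2]
      exact ⟨nofun, Or.inr (CDSEdge.rightLast _ _ (by simp only; omega))⟩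
    · simp only [walk, dif_neg h1, dif_pos h2]
      exact ⟨nofun, Or.inl (CDSEdge.rightFirst _ _ (by simp only; omega))⟩
    · omega

theorem mem_edgeSet_iff (hp : ∀ i, 3 ≤ p i) (hq : ∀ j, 3 ≤ q j) (s : Sym2 (CDSVertex x p q)) :
    s ∈ (cycleDoubleSpider x p q).edgeSet ↔ ∃ e, ends x p q e = s := by
  constructor
  · induction s with
    | _ u v =>
      intro h
      rw [SimpleGraph.mem_edgeSet, cycleDoubleSpider, SimpleGraph.fromRel_adj] at h
      rcases h.2 with h | h
      · exact exists_ends_of_edge hp hq h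
      · rw [Sym2.eq_swap]
        exact exists_ends_of_edge hp hq h
  · rintro ⟨⟨i, t⟩, rfl⟩
    exact adj_walk hp hq i t t.2

theorem eq_hub_or_eq_walk (v : CDSVertex x p q) :
    v = .mid 0 ∨ v = .mid (Fin.last x) ∨
      ∃ i t, t + 1 < len x p q i ∧ v = walk x p q i (t + 1) := by
  cases v with
  | mid s =>
    by_cases h0 : s = 0
    · exact Or.inl (congrArg _ h0)
    by_cases hl : s = Fin.last x
    · exact Or.inr (Or.inl (congrArg _ hl))
    simp only [Fin.ext_iff, Fin.val_zero, Fin.val_last] at h0 hl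
    have := s.2
    refine Or.inr (Or.inr ⟨.inl (), s - 1, by simp only [len, Sum.elim_inl]; omega, ?_⟩)
    simp only [walk, mid.injEq, Fin.ext_iff]
    omega
  | left i t =>
    have := t.2
    refine Or.inr (Or.inr ⟨.inr (.inl i), t,
      by simp only [len, Sum.elim_inr, Sum.elim_inl]; omega, ?_⟩)
    simp only [walk]
    rw [dif_pos (by omega)]
    rfl
  | right i t =>
    have := t.2
    refine Or.inr (Or.inr ⟨.inr (.inr i), t, by simp only [len, Sum.elim_inr]; omega, ?_⟩)
    simp only [walk]
    rw [dif_pos (by omega)]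
    rfl

/-! ### Vertex sums inside walks and at the hubs -/

theorem incidenceSum_walk (w : Unit ⊕ (Fin a ⊕ Fin b) → ℕ → ℕ) (i : Unit ⊕ (Fin a ⊕ Fin b))
    (t : ℕ) (ht : t + 1 < len x p q i) :
    incidenceSum (ends x p q) (fun e => w e.1 e.2) (walk x p q i (t + 1)) =
      w i t + w i (t + 1) := by
  classical
  unfold incidenceSum
  have hmem : ∀ e : Σ i, Fin (len x p q i), walk x p q i (t + 1) ∈ ends x p q e ↔
      e = ⟨i, ⟨t, by omega⟩⟩ ∨ e = ⟨i, ⟨t + 1, ht⟩⟩ := by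
    rintro ⟨j, s, hs⟩
    simp only [ends, Sym2.mem_iff]
    constructor
    · rintro (h | h)
      · rcases walk_eq_walk ht.le hs.le h with ⟨rfl, h'⟩ | h
        · cases h'
          exact Or.inr rfl
        · omega
      · rcases walk_eq_walk ht.le hs h with ⟨rfl, h'⟩ | h
        · obtain rfl : t = s := by omega
          exact Or.inl rfl
        · omega
    · rintro (h | h)
      · cases h
        exact Or.inr rfl
      · cases h
        exact Or.inl rfl
  rw [← Finset.sum_filter]
  have : (Finset.univ.filter fun e : Σ i, Fin (len x p q i) =>
      walk x p q i (t + 1) ∈ ends x p q e) =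
      {⟨i, ⟨t, by omega⟩⟩, ⟨i, ⟨t + 1, ht⟩⟩} := by
    ext e
    simp [hmem]
  rw [this, Finset.sum_pair]
  intro h
  simp at h

theorem sum_fin_ite_ends {n : ℕ} (hn : 2 ≤ n) (P : Fin n → Prop) [DecidablePred P] (w : ℕ → ℕ)
    (hP : ∀ t, P t ↔ t.val = 0 ∨ t.val + 1 = n) :
    ∑ t : Fin n, (if P t then w t else 0) = w 0 + w (n - 1) := by
  rw [← Finset.sum_filter]
  have : Finset.univ.filter P = {⟨0, by omega⟩, ⟨n - 1, by omega⟩} := by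
    ext t
    simp only [Finset.mem_filter, Finset.mem_univ, true_and, hP, Finset.mem_insert,
      Finset.mem_singleton, Fin.ext_iff]
    omega
  rw [this, Finset.sum_pair]
  simp [Fin.ext_iff]
  omega

theorem sum_fin_ite_single {n : ℕ} (k : ℕ) (hk : k < n) (P : Fin n → Prop) [DecidablePred P]
    (w : ℕ → ℕ) (hP : ∀ t, P t ↔ t.val = k) :
    ∑ t : Fin n, (if P t then w t else 0) = w k := by
  rw [← Finset.sum_filter]
  have : Finset.univ.filter P = {⟨k, hk⟩} := by
    ext t
    simp [hP, Fin.ext_iff]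
  rw [this, Finset.sum_singleton]

theorem incidenceSum_left_hub (hx : 1 ≤ x) (hp : ∀ i, 3 ≤ p i)
    (w : Unit ⊕ (Fin a ⊕ Fin b) → ℕ → ℕ) :
    incidenceSum (ends x p q) (fun e => w e.1 e.2) (.mid 0) =
      w (.inl ()) 0 + ∑ i, (w (.inr (.inl i)) 0 + w (.inr (.inl i)) (p i - 1)) := by
  classical
  unfold incidenceSum
  rw [Fintype.sum_sigma, Fintype.sum_sum_type, Fintype.sum_sum_type]
  congr 1
  · simp only [Finset.univ_unique, Finset.sum_singleton]
    refine sum_fin_ite_single 0 hx (fun t : Fin (len x p q (.inl ())) => _ ∈ ends x p q ⟨_, t⟩) _ fun t => ?_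
    have ht : t.val < x := t.2
    simp [ends, walk, Fin.ext_iff]
    omega
  -- Cycles at the other hub contribute nothing, since `1 ≤ x` keeps the hubs distinct.
  · rw [Finset.sum_eq_zero (s := (Finset.univ : Finset (Fin b))), add_zero]
    · refine Finset.sum_congr rfl fun i _ => ?_
      refine sum_fin_ite_ends ((Nat.le_succ 2).trans (hp i))
        (fun t : Fin (len x p q (.inr (.inl i))) => .mid 0 ∈ ends x p q ⟨_, t⟩) (w (.inr (.inl i))) fun t => ?_
      have ht : t.val < p i := t.2
      simp only [ends, walk, Sym2.mem_iff, len, Sum.elim_inl, Sum.elim_inr]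
      split_ifs <;> simp <;> omega
    · refine fun j _ => Finset.sum_eq_zero fun t _ => if_neg ?_
      simp only [ends, walk, Sym2.mem_iff]
      split_ifs <;> simp [Fin.ext_iff] <;> omega

theorem incidenceSum_right_hub (hx : 1 ≤ x) (hq : ∀ j, 3 ≤ q j)
    (w : Unit ⊕ (Fin a ⊕ Fin b) → ℕ → ℕ) :
    incidenceSum (ends x p q) (fun e => w e.1 e.2) (.mid (Fin.last x)) =
      w (.inl ()) (x - 1) + ∑ j, (w (.inr (.inr j)) 0 + w (.inr (.inr j)) (q j - 1)) := by
  classical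
  unfold incidenceSum
  rw [Fintype.sum_sigma, Fintype.sum_sum_type, Fintype.sum_sum_type]
  congr 1
  · simp only [Finset.univ_unique, Finset.sum_singleton]
    refine sum_fin_ite_single (x - 1) (Nat.sub_lt hx one_pos)
      (fun t : Fin (len x p q (.inl ())) => _ ∈ ends x p q ⟨_, t⟩) _ fun t => ?_
    have ht : t.val < x := t.2
    simp [ends, walk, Fin.ext_iff]
    omega
  · rw [Finset.sum_eq_zero (s := (Finset.univ : Finset (Fin a))), zero_add]
    · refine Finset.sum_congr rfl fun i _ => ?_
      refine sum_fin_ite_ends ((Nat.le_succ 2).trans (hq i))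
        (fun t : Fin (len x p q (.inr (.inr i))) => .mid (Fin.last x) ∈ ends x p q ⟨_, t⟩) (w (.inr (.inr i))) fun t => ?_
      have ht : t.val < q i := t.2
      simp only [ends, walk, Sym2.mem_iff, len, Sum.elim_inr]
      split_ifs <;> simp <;> omega
    · refine fun j _ => Finset.sum_eq_zero fun t _ => if_neg ?_
      simp only [ends, walk, Sym2.mem_iff]
      split_ifs <;> simp [Fin.ext_iff] <;> omega

end CDSVertex

/-! ### The main theorem -/

open CDSVertex in
theorem mainTheorem3 {V : Type*} [Fintype V] [DecidableEq V] (G : SimpleGraph V)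
    [DecidableRel G.Adj] (hG : IsCycleDoubleSpider G) : IsStronglyAntimagic G := by
  obtain ⟨x, a, b, p, q, hx, ha, hb, hp, hq, ⟨φ⟩⟩ := hG
  obtain ⟨P, L, R, h⟩ := exists_isSpiderLabeling p q hx ha hb hp hq
  have hcard : Fintype.card (Σ i, Fin (len x p q i)) = x + (∑ i, p i + ∑ j, q j) := by
    rw [Fintype.card_sigma, Fintype.sum_sum_type, Fintype.sum_sum_type]
    simp only [Fintype.card_fin]
    simp [len]
  set F : Unit ⊕ (Fin a ⊕ Fin b) → ℕ → ℕ := Sum.elim (fun _ => P) (Sum.elim L R) with hF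
  have hH : IsPathLabeling (len x p q) _ F := h.isPathLabeling
  have hl : ∀ i t, t + 1 < len x p q i → _ := h.lt_left
  have hr : ∀ i t, t + 1 < len x p q i → _ := h.lt_right
  have hne := h.ne
  have hleft := incidenceSum_left_hub (q := q) hx hp F
  have hright := incidenceSum_right_hub (p := p) hx hq F
  -- Constant weight 1 turns the sum formulas into degrees: `2a + 1` and `2b + 1` at the hubs, 2
  -- elsewhere.
  have hleft1 := incidenceSum_left_hub (q := q) hx hp fun _ _ => 1
  have hright1 := incidenceSum_right_hub (p := p) hx hq fun _ _ => 1
  have hwalk1 := incidenceSum_walk (x := x) (p := p) (q := q) fun _ _ => 1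
  simp only [Finset.sum_const, Finset.card_univ, Fintype.card_fin, smul_eq_mul] at hleft1 hright1
  refine isStronglyAntimagic_of_incidenceSum G
    (fun e => (ends x p q e).map φ.symm.toEquiv)
    ((Sym2.map.injective φ.symm.injective).comp (ends_injective hp hq)) ?_
    (fun e => F e.1 e.2) ?_ ?_ ?_ ?_
  · intro s
    rw [← φ.map_mem_edgeSet_iff, mem_edgeSet_iff hp hq]
    have h1 : φ.symm.toEquiv ∘ φ = id := funext φ.symm_apply_apply
    have h2 : φ ∘ φ.symm.toEquiv = id := funext φ.apply_symm_apply
    refine exists_congr fun e => ⟨fun h => ?_, fun h => ?_⟩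
    · rw [h, Sym2.map_map]
      exact (congrArg (Sym2.map · s) h1).trans (congrFun Sym2.map_id s)
    · rw [← h, Sym2.map_map]
      exact ((congrArg (Sym2.map · _) h2).trans (congrFun Sym2.map_id _)).symm
  · rintro ⟨i, s⟩ ⟨j, t⟩ e
    obtain ⟨rfl, e⟩ := hH.inj i j s t s.2 t.2 e
    rw [Fin.ext e]
  · rintro ⟨i, s⟩
    rw [hcard]
    exact ⟨hH.pos i s s.2, hH.le i s s.2⟩
  · intro u v huv
    rw [incidenceSum_map, incidenceSum_map]
    have huv' : φ u ≠ φ v := φ.injective.ne huv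
    change incidenceSum _ _ (φ u) ≠ incidenceSum _ _ (φ v)
    generalize φ u = u at *
    generalize φ v = v at *
    rcases eq_hub_or_eq_walk u with rfl | rfl | ⟨i, s, hs, rfl⟩ <;>
    rcases eq_hub_or_eq_walk v with rfl | rfl | ⟨j, t, ht, rfl⟩
    · exact absurd rfl huv'
    · rw [hleft, hright]; exact hne
    · rw [hleft, incidenceSum_walk F j t ht]; exact (hl j t ht).ne'
    · rw [hleft, hright]; exact hne.symm
    · exact absurd rfl huv'
    · rw [hright, incidenceSum_walk F j t ht]; exact (hr j t ht).ne'
    · rw [hleft, incidenceSum_walk F i s hs]; exact (hl i s hs).ne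
    · rw [hright, incidenceSum_walk F i s hs]; exact (hr i s hs).ne
    · rw [incidenceSum_walk F i s hs, incidenceSum_walk F j t ht]
      intro e
      obtain ⟨rfl, rfl⟩ := hH.sum_inj i j s t hs ht e
      exact huv' rfl
  · intro u v
    rw [incidenceSum_map, incidenceSum_map, incidenceSum_map, incidenceSum_map]
    change incidenceSum _ _ (φ v) < incidenceSum _ _ (φ u) →
      incidenceSum _ _ (φ v) < incidenceSum _ _ (φ u)
    generalize φ u = u
    generalize φ v = v
    rcases eq_hub_or_eq_walk u with rfl | rfl | ⟨i, s, hs, rfl⟩ <;>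
    rcases eq_hub_or_eq_walk v with rfl | rfl | ⟨j, t, ht, rfl⟩
    · exact fun h => absurd h (lt_irrefl _)
    · rw [hleft, hright, hleft1, hright1]
      exact fun e => h.right_lt_left (by omega)
    · rw [hleft, incidenceSum_walk F j t ht]; exact fun _ => hl j t ht
    · rw [hleft, hright, hleft1, hright1]
      exact fun e => h.left_lt_right (by omega)
    · exact fun h => absurd h (lt_irrefl _)
    · rw [hright, incidenceSum_walk F j t ht]; exact fun _ => hr j t ht
    -- Vacuous: a vertex of degree 2 cannot exceed a hub, which carries a cycle and so has degree at
    -- least 3.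
    · rw [hleft1, hwalk1 i s hs]; omega
    · rw [hright1, hwalk1 i s hs]; omega
    · rw [hwalk1 i s hs, hwalk1 j t ht]; omega
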